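/- Let $k$ be a field of characteristic zero and let $N\ge 0$ be an integer. Let $\mathcal E_N$ be the Fomin–Kirillov algebra, i.e. the unital associative $k$-algebra generated by symbols $[ij]$ for distinct $i,j\in\{1,\dots,N\}$ with relations $$[ij]=-[ji],\quad [ij]^2=0,\quad [ij][lm]=[lm][ij],\quad [ij][jl]+[jl][li]+[li][ij]=0$$ for all pairwise distinct $i,j,l,m\in\{1,\dots,N\}$ (each relation being imposed for all distinct choices of the indices occurring in it). For $n\ge 0$ let $\mathcal E_N^n$ denote the degree $n$ component, i.e. the linear span of all products of $n$ generators, with $\mathcal E_N^0=k\cdot 1$. If $\mathcal E_N$ is finite-dimensional over $k$, then it has a unique element of top degree up to scale: there is a largest $d$ with $\mathcal E_N^d\neq 0$, and there is a nonzero $x\in\mathcal E_N^d$ such that every element of $\mathcal E_N^d$ is a scalar multiple of $x$. -/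

import Mathlib

/-- Labels of the generators `[ij]`: ordered pairs of distinct indices. -/
abbrev FKIndex (N : ℕ) : Type := {p : Fin N × Fin N // p.1 ≠ p.2}

/-- The generator `[ij]` in the free associative algebra. -/
noncomputable def fkFreeGen (k : Type*) [Field k] {N : ℕ} (i j : Fin N) (h : i ≠ j) :
    FreeAlgebra k (FKIndex N) :=
  FreeAlgebra.ι k ⟨(i, j), h⟩

/-- The defining relations of the Fomin–Kirillov algebra, for pairwise distinct `i, j, l, m`:
`[ij] = -[ji]`, `[ij]² = 0`, `[ij][lm] = [lm][ij]`, `[ij][jl] + [jl][li] + [li][ij] = 0`. -/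
inductive FKRel (k : Type*) [Field k] (N : ℕ) :
    FreeAlgebra k (FKIndex N) → FreeAlgebra k (FKIndex N) → Prop
  | antisymm (i j : Fin N) (hij : i ≠ j) :
      FKRel k N (fkFreeGen k i j hij) (-fkFreeGen k j i hij.symm)
  | sq (i j : Fin N) (hij : i ≠ j) :
      FKRel k N (fkFreeGen k i j hij * fkFreeGen k i j hij) 0
  | comm (i j l m : Fin N) (hij : i ≠ j) (hlm : l ≠ m)
      (hil : i ≠ l) (him : i ≠ m) (hjl : j ≠ l) (hjm : j ≠ m) :
      FKRel k N (fkFreeGen k i j hij * fkFreeGen k l m hlm)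
        (fkFreeGen k l m hlm * fkFreeGen k i j hij)
  | cyclic (i j l : Fin N) (hij : i ≠ j) (hjl : j ≠ l) (hli : l ≠ i) :
      FKRel k N (fkFreeGen k i j hij * fkFreeGen k j l hjl
        + fkFreeGen k j l hjl * fkFreeGen k l i hli
        + fkFreeGen k l i hli * fkFreeGen k i j hij) 0

/-- The Fomin–Kirillov algebra `ℰ_N` over `k`. -/
def FominKirillov (k : Type*) [Field k] (N : ℕ) : Type _ := RingQuot (FKRel k N)

noncomputable instance (k : Type*) [Field k] (N : ℕ) : Ring (FominKirillov k N) :=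
  inferInstanceAs (Ring (RingQuot (FKRel k N)))

noncomputable instance (k : Type*) [Field k] (N : ℕ) : Algebra k (FominKirillov k N) :=
  inferInstanceAs (Algebra k (RingQuot (FKRel k N)))

/-- The quotient map from the free algebra. -/
noncomputable def fkMk (k : Type*) [Field k] (N : ℕ) :
    FreeAlgebra k (FKIndex N) →ₐ[k] FominKirillov k N :=
  RingQuot.mkAlgHom k (FKRel k N)

/-- The generator `[ij]` of `ℰ_N`. -/
noncomputable def fkGen (k : Type*) [Field k] {N : ℕ} (p : FKIndex N) : FominKirillov k N :=
  fkMk k N (fkFreeGen k p.1.1 p.1.2 p.2)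

/-- The degree `n` component of `ℰ_N`: the span of all products of `n` generators `[ij]`
(as a power of the span of the generators; for `n = 0` this is `k · 1`). -/
noncomputable def fkDegree (k : Type*) [Field k] (N n : ℕ) : Submodule k (FominKirillov k N) :=
  Submodule.span k (Set.range (fkGen k (N := N))) ^ n

/-- `d` is the top degree of `ℰ_N`: the largest degree whose component is nonzero. -/
def IsFKTopDegree (k : Type*) [Field k] (N d : ℕ) : Prop :=
  IsGreatest {n : ℕ | fkDegree k N n ≠ ⊥} d

/-!
Write `A` for the Fomin–Kirillov algebra, `A_n` for its components, and let the symmetric group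
act on `A` by permuting indices. `A` is a braided Hopf algebra whose coproduct makes each `[ij]`
primitive. The braided coproduct enters through the representation `fkCoprod` of `A` on `A ⊗ A` in
which `[ij]` acts as `X + Y`, where `X = [ij] · ⊗ id` and `Y = (i j) ⊗ [ij] ·`; thus
`Δ(z) = fkCoprod z (1 ⊗ 1)`.

Let `d` be the top degree and `z ∈ A_d`. Then `[ij] z = 0`, so `Y` and `-X` agree on `Δ(z)`. Since
`Y` commutes with left multiplications on the first factor up to the permutation action, it follows
that for a product `a` of generators the corresponding product of operators `Y` sends `Δ(z)` to
`(s ⊗ 1) Δ(z)` for some `s ∈ A` (`exists_fkDiagWord_apply_eq`). If `a` has degree `d`, comparing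
the parts of degree `d` in the second factor, where `Δ(z) = z ⊗ 1 + ⋯ + 1 ⊗ z`, gives
`(σ z) ⊗ a = s ⊗ z` with `σ` an automorphism. Hence for `z ≠ 0` each such monomial `a` is a multiple
of `z` (`exists_fkWord_eq_smul`), which forces `A_d` to be a line.
-/

open scoped TensorProduct

section

variable {k : Type*} [Field k] {N : ℕ}

/-! ### Universal property and permutation action -/

theorem fkGen_antisymm (i j : Fin N) (h : i ≠ j) :
    fkGen k ⟨(i, j), h⟩ = -fkGen k ⟨(j, i), h.symm⟩ := by
  have := RingQuot.mkAlgHom_rel k (FKRel.antisymm (k := k) i j h)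
  rw [map_neg] at this
  exact this

theorem fkGen_sq (i j : Fin N) (h : i ≠ j) :
    fkGen k ⟨(i, j), h⟩ * fkGen k ⟨(i, j), h⟩ = 0 := by
  have := RingQuot.mkAlgHom_rel k (FKRel.sq (k := k) i j h)
  rw [map_mul, map_zero] at this
  exact this

theorem fkGen_comm (i j l m : Fin N) (hij : i ≠ j) (hlm : l ≠ m)
    (hil : i ≠ l) (him : i ≠ m) (hjl : j ≠ l) (hjm : j ≠ m) :
    fkGen k ⟨(i, j), hij⟩ * fkGen k ⟨(l, m), hlm⟩
      = fkGen k ⟨(l, m), hlm⟩ * fkGen k ⟨(i, j), hij⟩ := by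
  have := RingQuot.mkAlgHom_rel k (FKRel.comm (k := k) i j l m hij hlm hil him hjl hjm)
  rw [map_mul, map_mul] at this
  exact this

theorem fkGen_cyclic (i j l : Fin N) (hij : i ≠ j) (hjl : j ≠ l) (hli : l ≠ i) :
    fkGen k ⟨(i, j), hij⟩ * fkGen k ⟨(j, l), hjl⟩
      + fkGen k ⟨(j, l), hjl⟩ * fkGen k ⟨(l, i), hli⟩
      + fkGen k ⟨(l, i), hli⟩ * fkGen k ⟨(i, j), hij⟩ = 0 := by
  have := RingQuot.mkAlgHom_rel k (FKRel.cyclic (k := k) i j l hij hjl hli)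
  rw [map_add, map_add, map_mul, map_mul, map_mul, map_zero] at this
  exact this

/-- A family of elements `f i j` satisfies the Fomin–Kirillov relations. -/
structure IsFKFamily {B : Type*} [Ring B] (f : FKIndex N → B) : Prop where
  antisymm (i j : Fin N) (hij : i ≠ j) : f ⟨(i, j), hij⟩ = -f ⟨(j, i), hij.symm⟩
  sq (i j : Fin N) (hij : i ≠ j) : f ⟨(i, j), hij⟩ * f ⟨(i, j), hij⟩ = 0
  comm (i j l m : Fin N) (hij : i ≠ j) (hlm : l ≠ m)
      (hil : i ≠ l) (him : i ≠ m) (hjl : j ≠ l) (hjm : j ≠ m) :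
      f ⟨(i, j), hij⟩ * f ⟨(l, m), hlm⟩ = f ⟨(l, m), hlm⟩ * f ⟨(i, j), hij⟩
  cyclic (i j l : Fin N) (hij : i ≠ j) (hjl : j ≠ l) (hli : l ≠ i) :
      f ⟨(i, j), hij⟩ * f ⟨(j, l), hjl⟩ + f ⟨(j, l), hjl⟩ * f ⟨(l, i), hli⟩
        + f ⟨(l, i), hli⟩ * f ⟨(i, j), hij⟩ = 0

/-- The algebra homomorphism out of the Fomin–Kirillov algebra with prescribed values on the
generators. -/
noncomputable def fkLift {B : Type*} [Ring B] [Algebra k B] (f : FKIndex N → B)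
    (hf : IsFKFamily f) : FominKirillov k N →ₐ[k] B :=
  RingQuot.liftAlgHom k ⟨FreeAlgebra.lift k f, by
    intro x y h
    cases h with
    | antisymm i j hij => simpa [fkFreeGen] using hf.antisymm i j hij
    | sq i j hij => simpa [fkFreeGen] using hf.sq i j hij
    | comm i j l m hij hlm hil him hjl hjm =>
      simpa [fkFreeGen] using hf.comm i j l m hij hlm hil him hjl hjm
    | cyclic i j l hij hjl hli => simpa [fkFreeGen] using hf.cyclic i j l hij hjl hli⟩

@[simp]
theorem fkLift_fkGen {B : Type*} [Ring B] [Algebra k B] (f : FKIndex N → B)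
    (hf : IsFKFamily f) (p : FKIndex N) : fkLift (k := k) f hf (fkGen k p) = f p := by
  refine (RingQuot.liftAlgHom_mkAlgHom_apply k _ _ _).trans ?_
  simp [fkFreeGen]

theorem fk_algHom_ext {B : Type*} [Ring B] [Algebra k B] {f g : FominKirillov k N →ₐ[k] B}
    (h : ∀ p, f (fkGen k p) = g (fkGen k p)) : f = g := by
  refine RingQuot.ringQuot_ext' k f g (FreeAlgebra.hom_ext (funext fun p => ?_))
  exact h p

/-- The action of a permutation `τ` of the indices: `[ij] ↦ [τ(i) τ(j)]`. -/
noncomputable def fkAct (k : Type*) [Field k] {N : ℕ} (τ : Equiv.Perm (Fin N)) :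
    FominKirillov k N →ₐ[k] FominKirillov k N :=
  fkLift (fun p => fkGen k ⟨(τ p.1.1, τ p.1.2), τ.injective.ne p.2⟩)
    { antisymm := fun _ _ _ => fkGen_antisymm _ _ _
      sq := fun _ _ _ => fkGen_sq _ _ _
      comm := fun _ _ _ _ _ _ h₁ h₂ h₃ h₄ => fkGen_comm _ _ _ _ _ _
        (τ.injective.ne h₁) (τ.injective.ne h₂) (τ.injective.ne h₃) (τ.injective.ne h₄)
      cyclic := fun _ _ _ _ _ _ => fkGen_cyclic _ _ _ _ _ _ }

theorem fkAct_fkGen (τ : Equiv.Perm (Fin N)) (i j : Fin N) (h : i ≠ j) :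
    fkAct k τ (fkGen k ⟨(i, j), h⟩) = fkGen k ⟨(τ i, τ j), τ.injective.ne h⟩ :=
  fkLift_fkGen _ _ _

theorem fkAct_mul (τ τ' : Equiv.Perm (Fin N)) :
    fkAct k (τ * τ') = (fkAct k τ).comp (fkAct k τ') :=
  fk_algHom_ext fun ⟨(i, j), h⟩ => by simp [fkAct_fkGen]

theorem fkAct_one : fkAct k (1 : Equiv.Perm (Fin N)) = AlgHom.id k _ :=
  fk_algHom_ext fun ⟨(i, j), h⟩ => by simp [fkAct_fkGen]

theorem fkAct_injective (τ : Equiv.Perm (Fin N)) : Function.Injective (fkAct k τ) := by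
  refine Function.LeftInverse.injective (g := fkAct k τ⁻¹) fun x => ?_
  rw [← AlgHom.comp_apply, ← fkAct_mul, inv_mul_cancel, fkAct_one, AlgHom.id_apply]

/-! ### Degrees -/

/-- The monomial in the generators given by a word in their labels. -/
noncomputable def fkWord (k : Type*) [Field k] {N : ℕ} (l : List (FKIndex N)) :
    FominKirillov k N :=
  (l.map (fkGen k)).prod

@[simp]
theorem fkWord_nil : fkWord k ([] : List (FKIndex N)) = 1 := rfl

@[simp]
theorem fkWord_cons (p : FKIndex N) (l : List (FKIndex N)) :
    fkWord k (p :: l) = fkGen k p * fkWord k l := by simp [fkWord]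

theorem fkDegree_eq_span (n : ℕ) :
    fkDegree k N n = Submodule.span k
      {x | ∃ l : List (FKIndex N), l.length = n ∧ fkWord k l = x} := by
  induction n with
  | zero =>
    rw [fkDegree, pow_zero, Submodule.one_eq_span]
    congr 1
    ext x
    constructor
    · rintro rfl
      exact ⟨[], rfl, rfl⟩
    · rintro ⟨l, hl, rfl⟩
      rw [List.length_eq_zero_iff.mp hl]
      rfl
  | succ n ih =>
    rw [fkDegree, pow_succ', ← fkDegree, ih, Submodule.span_mul_span]
    congr 1
    ext x
    simp only [Set.mem_mul, Set.mem_range, Set.mem_ofPred_eq]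
    constructor
    · rintro ⟨_, ⟨p, rfl⟩, _, ⟨l, hl, rfl⟩, rfl⟩
      exact ⟨p :: l, by simp [hl], by simp⟩
    · rintro ⟨l, hl, rfl⟩
      obtain _ | ⟨p, l⟩ := l
      · simp at hl
      · exact ⟨_, ⟨p, rfl⟩, _, ⟨l, by simpa using hl, rfl⟩, by simp⟩

theorem fkWord_mem_fkDegree (l : List (FKIndex N)) : fkWord k l ∈ fkDegree k N l.length := by
  rw [fkDegree_eq_span]
  exact Submodule.subset_span ⟨l, rfl, rfl⟩

/-- The algebra homomorphism `A → A[t]` sending `[ij]` to `[ij] t`; it records degrees. -/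
noncomputable def fkGrade (k : Type*) [Field k] (N : ℕ) :
    FominKirillov k N →ₐ[k] Polynomial (FominKirillov k N) :=
  fkLift (fun p => Polynomial.monomial 1 (fkGen k p))
    { antisymm := fun i j h => by rw [fkGen_antisymm i j h, map_neg]
      sq := fun i j h => by rw [Polynomial.monomial_mul_monomial, fkGen_sq, map_zero]
      comm := fun i j l m hij hlm h₁ h₂ h₃ h₄ => by
        rw [Polynomial.monomial_mul_monomial, fkGen_comm i j l m hij hlm h₁ h₂ h₃ h₄,
          Polynomial.monomial_mul_monomial]
      cyclic := fun i j l h₁ h₂ h₃ => by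
        simp only [Polynomial.monomial_mul_monomial]
        rw [← map_add, ← map_add, fkGen_cyclic, map_zero] }

theorem fkGrade_word (l : List (FKIndex N)) :
    fkGrade k N (fkWord k l) = Polynomial.monomial l.length (fkWord k l) := by
  induction l with
  | nil => simp
  | cons p l ih =>
    rw [fkWord_cons, map_mul, ih, fkGrade, fkLift_fkGen, Polynomial.monomial_mul_monomial,
      List.length_cons, add_comm]

/-- The projection of the Fomin–Kirillov algebra to its component of degree `n`. -/
noncomputable def fkProj (k : Type*) [Field k] (N n : ℕ) :
    FominKirillov k N →ₗ[k] FominKirillov k N :=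
  (Polynomial.lcoeff (FominKirillov k N) n).restrictScalars k ∘ₗ (fkGrade k N).toLinearMap

theorem fkProj_apply (n : ℕ) (x : FominKirillov k N) :
    fkProj k N n x = (fkGrade k N x).coeff n := rfl

theorem fkProj_word (n : ℕ) (l : List (FKIndex N)) :
    fkProj k N n (fkWord k l) = if l.length = n then fkWord k l else 0 := by
  rw [fkProj_apply, fkGrade_word, Polynomial.coeff_monomial]

theorem fkProj_of_mem {n : ℕ} {x : FominKirillov k N} (hx : x ∈ fkDegree k N n) (m : ℕ) :
    fkProj k N m x = if n = m then x else 0 := by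
  rw [fkDegree_eq_span] at hx
  induction hx using Submodule.span_induction with
  | mem x h => obtain ⟨l, rfl, rfl⟩ := h; exact fkProj_word m l
  | zero => simp
  | add x y _ _ hx hy => rw [map_add, hx, hy]; split_ifs <;> simp
  | smul c x _ hx => rw [map_smul, hx]; split_ifs <;> simp

theorem fkProj_succ_gen_mul (n : ℕ) (p : FKIndex N) (x : FominKirillov k N) :
    fkProj k N (n + 1) (fkGen k p * x) = fkGen k p * fkProj k N n x := by
  rw [fkProj_apply, map_mul, fkGrade, fkLift_fkGen, ← fkGrade, add_comm n 1,
    ← Polynomial.C_mul_X_pow_eq_monomial, mul_assoc, Polynomial.coeff_C_mul, add_comm 1 n, pow_one,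
    Polynomial.coeff_X_mul, fkProj_apply]

theorem fkProj_zero_gen_mul (p : FKIndex N) (x : FominKirillov k N) :
    fkProj k N 0 (fkGen k p * x) = 0 := by
  rw [fkProj_apply, map_mul, fkGrade, fkLift_fkGen, ← fkGrade, Polynomial.mul_coeff_zero,
    Polynomial.coeff_monomial, if_neg one_ne_zero, zero_mul]

instance fk_nontrivial : Nontrivial (FominKirillov k N) :=
  (fkLift (k := k) (fun _ : FKIndex N => (0 : k))
    { antisymm := by simp
      sq := by simp
      comm := by simp
      cyclic := by simp }).toRingHom.domain_nontrivial

theorem exists_isFKTopDegree [FiniteDimensional k (FominKirillov k N)] :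
    ∃ d, IsFKTopDegree k N d := by
  have hfin : {n | fkDegree k N n ≠ ⊥}.Finite := by
    choose x hx hx0 using fun n : {n | fkDegree k N n ≠ ⊥} =>
      Submodule.exists_mem_ne_zero_of_ne_bot n.2
    have hli : LinearIndependent k x := by
      rw [linearIndependent_iff']
      intro s c hc i hi
      have h := congrArg (fkProj k N i) hc
      simp only [map_sum, map_smul, map_zero] at h
      rw [Finset.sum_eq_single i] at h
      · rw [fkProj_of_mem (hx i), if_pos rfl] at h
        exact (smul_eq_zero.mp h).resolve_right (hx0 i)
      · intro j _ hj
        rw [fkProj_of_mem (hx j), if_neg (fun h => hj (Subtype.ext h)), smul_zero]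
      · exact fun h => absurd hi h
    have := hli.finite
    exact Set.toFinite _
  have hne : {n | fkDegree k N n ≠ ⊥}.Nonempty := by
    refine ⟨0, fun h => one_ne_zero (α := FominKirillov k N) ?_⟩
    rw [← Submodule.mem_bot k, ← h]
    exact fkWord_mem_fkDegree []
  obtain ⟨d, hd, hmax⟩ := Set.exists_max_image _ id hfin hne
  exact ⟨d, hd, hmax⟩

/-! ### The braided coproduct -/

/-- Left multiplication by `x` on the first tensor factor. -/
noncomputable def fkLeft (x : FominKirillov k N) :
    Module.End k (FominKirillov k N ⊗[k] FominKirillov k N) :=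
  TensorProduct.map (LinearMap.mulLeft k x) LinearMap.id

/-- Left multiplication by `1 ⊗ [ij]` in the braided tensor square: the transposition `(i j)` acts
on the first factor and `[ij]` multiplies the second. -/
noncomputable def fkDiag (p : FKIndex N) :
    Module.End k (FominKirillov k N ⊗[k] FominKirillov k N) :=
  TensorProduct.map (fkAct k (Equiv.swap p.1.1 p.1.2)).toLinearMap
    (LinearMap.mulLeft k (fkGen k p))

@[simp]
theorem fkLeft_tmul (x a b : FominKirillov k N) : fkLeft x (a ⊗ₜ[k] b) = (x * a) ⊗ₜ b := rfl

@[simp]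
theorem fkDiag_tmul (p : FKIndex N) (a b : FominKirillov k N) :
    fkDiag p (a ⊗ₜ[k] b) = fkAct k (Equiv.swap p.1.1 p.1.2) a ⊗ₜ (fkGen k p * b) := rfl

theorem fkLeft_mul (x y : FominKirillov k N) : fkLeft (x * y) = fkLeft x * fkLeft y :=
  TensorProduct.ext' fun a b => by simp [mul_assoc]

theorem fkLeft_neg (x : FominKirillov k N) : fkLeft (-x) = -fkLeft x :=
  TensorProduct.ext' fun a b => by simp [TensorProduct.neg_tmul]

theorem fkLeft_neg_mul (x : FominKirillov k N)
    (T : Module.End k (FominKirillov k N ⊗[k] FominKirillov k N)) :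
    fkLeft (-x) * T = -(fkLeft x * T) :=
  LinearMap.ext fun w => by rw [fkLeft_neg]; rfl

theorem fkLeft_add (x y : FominKirillov k N) : fkLeft (x + y) = fkLeft x + fkLeft y :=
  TensorProduct.ext' fun a b => by simp [add_mul, TensorProduct.add_tmul]

theorem fkLeft_zero : fkLeft (0 : FominKirillov k N) = 0 :=
  TensorProduct.ext' fun a b => by simp

theorem fkDiag_mul_fkLeft (p : FKIndex N) (x : FominKirillov k N) :
    fkDiag p * fkLeft x = fkLeft (fkAct k (Equiv.swap p.1.1 p.1.2) x) * fkDiag p :=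
  TensorProduct.ext' fun a b => by simp

theorem fkDiag_mul_fkDiag_tmul (p q : FKIndex N) (a b : FominKirillov k N) :
    (fkDiag p * fkDiag q : Module.End k _) (a ⊗ₜ[k] b)
      = fkAct k (Equiv.swap p.1.1 p.1.2 * Equiv.swap q.1.1 q.1.2) a
        ⊗ₜ (fkGen k p * fkGen k q * b) := by
  simp [fkAct_mul, mul_assoc]

theorem isFKFamily_fkDiag : IsFKFamily (fkDiag (k := k) (N := N)) where
  antisymm i j h := TensorProduct.ext' fun a b => by
    simp [fkGen_antisymm i j h, Equiv.swap_comm i j, TensorProduct.tmul_neg]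
  sq i j h := TensorProduct.ext' fun a b => by
    rw [fkDiag_mul_fkDiag_tmul, fkGen_sq, zero_mul, TensorProduct.tmul_zero, LinearMap.zero_apply]
  comm i j l m hij hlm h₁ h₂ h₃ h₄ := TensorProduct.ext' fun a b => by
    have hs : Equiv.swap i j * Equiv.swap l m = Equiv.swap l m * Equiv.swap i j := by
      rw [Equiv.mul_swap_eq_swap_mul, Equiv.swap_apply_of_ne_of_ne h₁.symm h₃.symm,
        Equiv.swap_apply_of_ne_of_ne h₂.symm h₄.symm]
    rw [fkDiag_mul_fkDiag_tmul, fkDiag_mul_fkDiag_tmul, hs,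
      fkGen_comm i j l m hij hlm h₁ h₂ h₃ h₄]
  cyclic i j l h₁ h₂ h₃ := TensorProduct.ext' fun a b => by
    -- The three products of transpositions are the same 3-cycle.
    have hs₁ : Equiv.swap j l * Equiv.swap l i = Equiv.swap i j * Equiv.swap j l := by
      rw [Equiv.mul_swap_eq_swap_mul, Equiv.swap_apply_right,
        Equiv.swap_apply_of_ne_of_ne h₁ h₃.symm, Equiv.swap_comm j i]
    have hs₂ : Equiv.swap l i * Equiv.swap i j = Equiv.swap i j * Equiv.swap j l := by
      rw [← hs₁, Equiv.mul_swap_eq_swap_mul, Equiv.swap_apply_right,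
        Equiv.swap_apply_of_ne_of_ne h₂ h₁.symm, Equiv.swap_comm l j]
    simp only [LinearMap.add_apply, fkDiag_mul_fkDiag_tmul]
    rw [hs₁, hs₂, ← TensorProduct.tmul_add, ← TensorProduct.tmul_add, ← add_mul, ← add_mul,
      fkGen_cyclic, zero_mul, TensorProduct.tmul_zero, LinearMap.zero_apply]

theorem isFKFamily_fkLeft_add_fkDiag :
    IsFKFamily fun p : FKIndex N => fkLeft (fkGen k p) + fkDiag p where
  antisymm i j h := by
    rw [fkGen_antisymm i j h, fkLeft_neg, isFKFamily_fkDiag.antisymm i j h, neg_add]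
  sq i j h := by
    simp only [mul_add, add_mul, ← fkLeft_mul, fkDiag_mul_fkLeft, isFKFamily_fkDiag.sq i j h,
      fkGen_sq, fkAct_fkGen, Equiv.swap_apply_left, Equiv.swap_apply_right]
    rw [fkGen_antisymm j i, fkLeft_neg_mul, fkLeft_zero]
    abel
  comm i j l m hij hlm h₁ h₂ h₃ h₄ := by
    simp only [mul_add, add_mul, ← fkLeft_mul, fkDiag_mul_fkLeft,
      isFKFamily_fkDiag.comm i j l m hij hlm h₁ h₂ h₃ h₄, fkAct_fkGen,
      Equiv.swap_apply_of_ne_of_ne h₁ h₂, Equiv.swap_apply_of_ne_of_ne h₃ h₄,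
      Equiv.swap_apply_of_ne_of_ne h₁.symm h₃.symm, Equiv.swap_apply_of_ne_of_ne h₂.symm h₄.symm,
      fkGen_comm i j l m hij hlm h₁ h₂ h₃ h₄]
    abel
  cyclic i j l h₁ h₂ h₃ := by
    have hL := congrArg fkLeft (fkGen_cyclic (k := k) i j l h₁ h₂ h₃)
    have hD := isFKFamily_fkDiag (k := k).cyclic i j l h₁ h₂ h₃
    simp only [fkLeft_add, fkLeft_mul, fkLeft_zero] at hL
    simp only [mul_add, add_mul, fkDiag_mul_fkLeft, fkAct_fkGen,
      Equiv.swap_apply_right, Equiv.swap_apply_of_ne_of_ne h₁ h₃.symm,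
      Equiv.swap_apply_of_ne_of_ne h₂ h₁.symm, Equiv.swap_apply_of_ne_of_ne h₃ h₂.symm]
    rw [fkGen_antisymm i l, fkGen_antisymm j i, fkGen_antisymm l j, fkLeft_neg_mul,
      fkLeft_neg_mul, fkLeft_neg_mul]
    -- The mixed terms cancel in pairs.
    refine Eq.trans ?_ ((congrArg₂ (· + ·) hL hD).trans (add_zero 0))
    abel

/-- The representation of the Fomin–Kirillov algebra on the braided tensor square in which `x` acts
as left multiplication by its coproduct. -/
noncomputable def fkCoprod (k : Type*) [Field k] (N : ℕ) :
    FominKirillov k N →ₐ[k] Module.End k (FominKirillov k N ⊗[k] FominKirillov k N) :=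
  fkLift _ isFKFamily_fkLeft_add_fkDiag

theorem fkCoprod_fkGen (p : FKIndex N) :
    fkCoprod k N (fkGen k p) = fkLeft (fkGen k p) + fkDiag p :=
  fkLift_fkGen _ _ _

/-- The projection of `A ⊗ A` to the part of degree `n` in the second factor. -/
noncomputable def fkProjSnd (k : Type*) [Field k] (N n : ℕ) :
    Module.End k (FominKirillov k N ⊗[k] FominKirillov k N) :=
  TensorProduct.map LinearMap.id (fkProj k N n)

@[simp]
theorem fkProjSnd_tmul (n : ℕ) (a b : FominKirillov k N) :
    fkProjSnd k N n (a ⊗ₜ[k] b) = a ⊗ₜ fkProj k N n b := rfl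

theorem fkProjSnd_fkLeft (n : ℕ) (x : FominKirillov k N)
    (w : FominKirillov k N ⊗[k] FominKirillov k N) :
    fkProjSnd k N n (fkLeft x w) = fkLeft x (fkProjSnd k N n w) := by
  refine LinearMap.congr_fun (f := fkProjSnd k N n * fkLeft x) (g := fkLeft x * fkProjSnd k N n)
    (TensorProduct.ext' fun a b => ?_) w
  simp

theorem fkProjSnd_succ_fkDiag (n : ℕ) (p : FKIndex N)
    (w : FominKirillov k N ⊗[k] FominKirillov k N) :
    fkProjSnd k N (n + 1) (fkDiag p w) = fkDiag p (fkProjSnd k N n w) := by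
  refine LinearMap.congr_fun (f := fkProjSnd k N (n + 1) * fkDiag p)
    (g := fkDiag p * fkProjSnd k N n) (TensorProduct.ext' fun a b => ?_) w
  simp [fkProj_succ_gen_mul]

theorem fkProjSnd_zero_fkDiag (p : FKIndex N)
    (w : FominKirillov k N ⊗[k] FominKirillov k N) :
    fkProjSnd k N 0 (fkDiag p w) = 0 := by
  refine LinearMap.congr_fun (f := fkProjSnd k N 0 * fkDiag p) (g := 0)
    (TensorProduct.ext' fun a b => ?_) w
  simp [fkProj_zero_gen_mul]

/-- The extreme terms of the coproduct `Δ(z) = z ⊗ 1 + ⋯ + 1 ⊗ z` of a monomial. -/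
theorem fkProjSnd_fkCoprod_word (l : List (FKIndex N)) :
    fkProjSnd k N 0 (fkCoprod k N (fkWord k l) (1 ⊗ₜ 1)) = fkWord k l ⊗ₜ 1 ∧
    fkProjSnd k N l.length (fkCoprod k N (fkWord k l) (1 ⊗ₜ 1)) = 1 ⊗ₜ fkWord k l ∧
    ∀ m > l.length, fkProjSnd k N m (fkCoprod k N (fkWord k l) (1 ⊗ₜ 1)) = 0 := by
  induction l with
  | nil =>
    have h (m : ℕ) := fkProj_word (k := k) (N := N) m []
    simp only [fkWord_nil, List.length_nil] at h
    refine ⟨by simp [h], by simp [h], fun m hm => ?_⟩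
    have hm0 : 0 ≠ m := Nat.ne_of_lt hm
    simp [h, hm0]
  | cons p l ih =>
    obtain ⟨h₀, h₁, h₂⟩ := ih
    simp only [fkWord_cons, map_mul, Module.End.mul_apply, fkCoprod_fkGen, LinearMap.add_apply,
      map_add, fkProjSnd_fkLeft, List.length_cons]
    refine ⟨?_, ?_, fun m hm => ?_⟩
    · rw [h₀, fkProjSnd_zero_fkDiag, add_zero, fkLeft_tmul]
    · rw [h₂ _ (Nat.lt_succ_self _), fkProjSnd_succ_fkDiag, h₁, map_zero, zero_add, fkDiag_tmul,
        map_one]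
    · obtain ⟨m, rfl⟩ := Nat.exists_eq_succ_of_ne_zero (Nat.ne_zero_of_lt hm)
      rw [h₂ _ (by omega), Nat.succ_eq_add_one, fkProjSnd_succ_fkDiag, h₂ _ (by omega), map_zero,
        map_zero, add_zero]

theorem fkProjSnd_fkCoprod_of_mem {n : ℕ} {z : FominKirillov k N} (hz : z ∈ fkDegree k N n) :
    fkProjSnd k N 0 (fkCoprod k N z (1 ⊗ₜ 1)) = z ⊗ₜ 1 ∧
    fkProjSnd k N n (fkCoprod k N z (1 ⊗ₜ 1)) = 1 ⊗ₜ z := by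
  rw [fkDegree_eq_span] at hz
  induction hz using Submodule.span_induction with
  | mem x h =>
    obtain ⟨l, rfl, rfl⟩ := h
    exact ⟨(fkProjSnd_fkCoprod_word l).1, (fkProjSnd_fkCoprod_word l).2.1⟩
  | zero => simp
  | add x y _ _ hx hy =>
    simp [hx.1, hx.2, hy.1, hy.2, TensorProduct.add_tmul, TensorProduct.tmul_add]
  | smul c x _ hx => simp [hx.1, hx.2, TensorProduct.smul_tmul']

/-! ### The top degree -/

/-- The product of the operators `fkDiag` along a word. -/
noncomputable def fkDiagWord (k : Type*) [Field k] {N : ℕ} (l : List (FKIndex N)) :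
    Module.End k (FominKirillov k N ⊗[k] FominKirillov k N) :=
  (l.map fkDiag).prod

theorem fkDiagWord_cons (p : FKIndex N) (l : List (FKIndex N)) :
    fkDiagWord k (p :: l) = fkDiag p * fkDiagWord k l := by simp [fkDiagWord]

theorem fkProjSnd_fkDiagWord (l : List (FKIndex N))
    (w : FominKirillov k N ⊗[k] FominKirillov k N) :
    fkProjSnd k N l.length (fkDiagWord k l w) = fkDiagWord k l (fkProjSnd k N 0 w) := by
  induction l with
  | nil => simp [fkDiagWord]
  | cons p l ih =>
    rw [fkDiagWord_cons, List.length_cons, Module.End.mul_apply, fkProjSnd_succ_fkDiag, ih,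
      Module.End.mul_apply]

theorem exists_fkDiagWord_tmul (l : List (FKIndex N)) :
    ∃ τ : Equiv.Perm (Fin N), ∀ a b : FominKirillov k N,
      fkDiagWord k l (a ⊗ₜ b) = fkAct k τ a ⊗ₜ (fkWord k l * b) := by
  induction l with
  | nil => exact ⟨1, fun a b => by simp [fkDiagWord, fkAct_one]⟩
  | cons p l ih =>
    obtain ⟨τ, h⟩ := ih
    refine ⟨Equiv.swap p.1.1 p.1.2 * τ, fun a b => ?_⟩
    rw [fkDiagWord_cons, Module.End.mul_apply, h, fkDiag_tmul, fkAct_mul, fkWord_cons, mul_assoc,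
      AlgHom.comp_apply]

/-- On a vector killed by all generators, a product of the operators `fkDiag` acts as a left
multiplication on the first factor; the multiplier is the braided antipode of the monomial, by
`S([ij] y) = (i j)(S(y)) * -[ij]`. -/
theorem exists_fkDiagWord_apply_eq {w : FominKirillov k N ⊗[k] FominKirillov k N}
    (hw : ∀ p, fkCoprod k N (fkGen k p) w = 0) (l : List (FKIndex N)) :
    ∃ s : FominKirillov k N, fkDiagWord k l w = fkLeft s w := by
  induction l with
  | nil =>
    refine ⟨1, ?_⟩
    rw [fkLeft, LinearMap.mulLeft_one, TensorProduct.map_id]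
    rfl
  | cons p l ih =>
    obtain ⟨s, h⟩ := ih
    refine ⟨fkAct k (Equiv.swap p.1.1 p.1.2) s * -fkGen k p, ?_⟩
    have hp := hw p
    rw [fkCoprod_fkGen, LinearMap.add_apply, add_comm, add_eq_zero_iff_eq_neg] at hp
    rw [fkDiagWord_cons, Module.End.mul_apply, h, ← Module.End.mul_apply, fkDiag_mul_fkLeft,
      Module.End.mul_apply, hp, fkLeft_mul, fkLeft_neg, Module.End.mul_apply, LinearMap.neg_apply]

theorem exists_fkWord_eq_smul {d : ℕ} (hd : IsFKTopDegree k N d) {z : FominKirillov k N}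
    (hz : z ∈ fkDegree k N d) (hz0 : z ≠ 0) (l : List (FKIndex N)) (hl : l.length = d) :
    ∃ c : k, fkWord k l = c • z := by
  have htop (p : FKIndex N) : fkGen k p * z = 0 := by
    have hbot : fkDegree k N (d + 1) = ⊥ := by
      by_contra h
      exact absurd (hd.2 h) (by simp)
    rw [← Submodule.mem_bot k, ← hbot, fkDegree, pow_succ']
    exact Submodule.mul_mem_mul (Submodule.subset_span ⟨p, rfl⟩) hz
  obtain ⟨s, hs⟩ := exists_fkDiagWord_apply_eq (w := fkCoprod k N z (1 ⊗ₜ 1))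
    (fun p => by rw [← Module.End.mul_apply, ← map_mul, htop, map_zero, LinearMap.zero_apply]) l
  obtain ⟨τ, hτ⟩ := exists_fkDiagWord_tmul (k := k) l
  obtain ⟨h₀, h₁⟩ := fkProjSnd_fkCoprod_of_mem hz
  have key : fkAct k τ z ⊗ₜ[k] fkWord k l = s ⊗ₜ z := by
    have h := congrArg (fkProjSnd k N d) hs
    rw [fkProjSnd_fkLeft, h₁, fkLeft_tmul, mul_one, ← hl, fkProjSnd_fkDiagWord, h₀, hτ,
      mul_one] at h
    exact h
  have hne : fkAct k τ z ≠ 0 := (map_ne_zero_iff _ (fkAct_injective τ)).mpr hz0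
  obtain ⟨f, hf⟩ : ∃ f : Module.Dual k (FominKirillov k N), f (fkAct k τ z) ≠ 0 := by
    by_contra! h
    exact hne ((Module.forall_dual_apply_eq_zero_iff k _).mp h)
  have h := congrArg (fun w => TensorProduct.lid k _ (f.rTensor _ w)) key
  simp only [LinearMap.rTensor_tmul, TensorProduct.lid_tmul] at h
  refine ⟨(f (fkAct k τ z))⁻¹ * f s, ?_⟩
  rw [mul_smul, ← h, inv_smul_smul₀ hf]

end

theorem corollary6p2 (k : Type*) [Field k] [CharZero k] (N : ℕ)
    (hfin : FiniteDimensional k (FominKirillov k N)) :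
    ∃ d : ℕ, IsFKTopDegree k N d ∧
      ∃ x ∈ fkDegree k N d, x ≠ 0 ∧ ∀ y ∈ fkDegree k N d, ∃ c : k, y = c • x := by
  obtain ⟨d, hd⟩ := exists_isFKTopDegree (k := k) (N := N)
  obtain ⟨l, hl, hl0⟩ : ∃ l : List (FKIndex N), l.length = d ∧ fkWord k l ≠ 0 := by
    by_contra! h
    refine hd.1 ?_
    rw [fkDegree_eq_span, Submodule.span_eq_bot]
    rintro _ ⟨l, hl, rfl⟩
    exact h l hl
  refine ⟨d, hd, fkWord k l, hl ▸ fkWord_mem_fkDegree l, hl0, fun y hy => ?_⟩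
  by_cases hy0 : y = 0
  · exact ⟨0, by rw [hy0, zero_smul]⟩
  · obtain ⟨c, hc⟩ := exists_fkWord_eq_smul hd hy hy0 l hl
    have hc0 : c ≠ 0 := by
      rintro rfl
      exact hl0 (by rw [hc, zero_smul])
    exact ⟨c⁻¹, by rw [hc, inv_smul_smul₀ hc0]⟩
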